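/- Let $H$ be a complex Hilbert space, let $A\in B(H)$ be a normal operator with spectrum $\sigma(A)$ and spectral measure $E_A$, and let $U\subseteq\mathbb{C}$ be an open set containing $\sigma(A)$. Let $p_1,\dots,p_K$ be holomorphic functions on $U$ with $\sup_{\lambda\in\sigma(A)}|p_k(\lambda)|\le 1$ for every $k$. Let $f=p_K\circ\cdots\circ p_1$ and let $f^m$ denote the $m$-fold composition of $f$ with itself; it is assumed that all these compositions are defined on $\sigma(A)$, that is, $p_{k}\circ\cdots\circ p_1\circ f^m$ maps $\sigma(A)$ into $U$ for all $m\ge 0$ and $0\le k<K$. Define $A^{(0)}=A$ and $A^{(m+1)}=f(A^{(m)})$ by the functional calculus of normal operators. Then the following hold. (i) (Finite stages.) For every $m\ge 1$, $A^{(m)}=f^m(A)$ and $$\sigma(A^{(m)})=\sigma(f^m(A))=f^m(\sigma(A)).$$ (ii) (Limit stage.) Suppose that $\sup_m\sup_{\lambda\in\sigma(A)}|f^m(\lambda)|<\infty$ and that $f^m(\lambda)\to\chi(\lambda)$ for every $\lambda\in\sigma(A)$, where $\chi:\sigma(A)\to\mathbb{C}$. Then the limit $A^{(\omega)}=\lim_{m\to\infty}A^{(m)}$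 exists in the strong operator topology, $A^{(\omega)}=\chi(A)=\int_{\sigma(A)}\chi\,dE_A$, and $$\sigma(A^{(\omega)})=\sigma(\chi(A))\subseteq\overline{\chi(\sigma(A))}.$$ In particular, if $\chi$ takes only the values $0$ and $1$, then $P=A^{(\omega)}$ is an orthogonal projection and $\sigma(P)\subseteq\{0,1\}$; moreover $\sigma(P)=\{0,1\}$ unless $P=0$ or $P=I$. -/

import Mathlib

open Filter Topology MeasureTheory
open scoped InnerProductSpace

noncomputable section

namespace SpectralIteration

/-! ### Scalar spectral measures and the bounded Borel functional calculus of a normal operator -/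

section BorelCalculus

open scoped CompactlySupported ComplexOrder

variable {H : Type*} [NormedAddCommGroup H] [InnerProductSpace ℂ H] [CompleteSpace H]

/-- A real continuous function on the spectrum, viewed as a complex one. -/
def complexify (A : H →L[ℂ] H) (φ : C_c(spectrum ℂ A, ℝ)) : C(spectrum ℂ A, ℂ) :=
  ⟨fun z => ((φ z : ℝ) : ℂ), by fun_prop⟩

/-- The positive functional `φ ↦ ⟪x, φ(A) x⟫` on the real continuous functions on `σ(A)`, where
`φ(A)` is the continuous functional calculus of the normal operator `A`. (The spectrum is compact,
so compact support is no restriction, and `⟪x, φ(A) x⟫` is real.) -/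
def spectralFunctional (A : H →L[ℂ] H) [IsStarNormal A] (x : H) :
    C_c(spectrum ℂ A, ℝ) →ₚ[ℝ] ℝ :=
  PositiveLinearMap.mk₀
    { toFun := fun φ => (⟪x, cfcHom (R := ℂ) (p := IsStarNormal) (a := A) inferInstance
        (complexify A φ) x⟫_ℂ).re
      map_add' := fun φ ψ => by
        have h : complexify A (φ + ψ) = complexify A φ + complexify A ψ := by
          ext z; simp [complexify]
        rw [h, map_add]
        simp
      map_smul' := fun c φ => by
        have h : complexify A (c • φ) = (c : ℂ) • complexify A φ := by
          ext z; simp [complexify]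
        rw [h, map_smul]
        simp }
    (fun φ hφ => by
      have h : (0 : H →L[ℂ] H) ≤ cfcHom (R := ℂ) (p := IsStarNormal) (a := A) inferInstance
          (complexify A φ) := by
        rw [cfcHom_nonneg_iff]
        intro z
        have := hφ z
        simpa [complexify] using Complex.zero_le_real.2 this
      rw [ContinuousLinearMap.nonneg_iff_isPositive] at h
      exact h.re_inner_nonneg_right x)

/-- The scalar spectral measure `μ_x(B) = ⟪x, E_A(B) x⟫` of the normal operator `A` at `x`: the
Borel measure on `σ(A)` that represents the functional `φ ↦ ⟪x, φ(A) x⟫`. -/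
def spectralMeasure (A : H →L[ℂ] H) [IsStarNormal A] (x : H) : Measure (spectrum ℂ A) :=
  RealRMK.rieszMeasure (spectralFunctional A x)

instance (A : H →L[ℂ] H) [IsStarNormal A] (x : H) : IsFiniteMeasure (spectralMeasure A x) := by
  unfold spectralMeasure; infer_instance

theorem integral_spectralMeasure (A : H →L[ℂ] H) [IsStarNormal A] (x : H)
    (φ : C_c(spectrum ℂ A, ℝ)) :
    ∫ z, φ z ∂(spectralMeasure A x) = (⟪x, cfcHom (R := ℂ) (p := IsStarNormal) (a := A)
      inferInstance (complexify A φ) x⟫_ℂ).re :=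
  RealRMK.integral_rieszMeasure _ φ

theorem integrable_compactlySupported (A : H →L[ℂ] H) (μ : Measure (spectrum ℂ A))
    [IsFiniteMeasure μ] (φ : C_c(spectrum ℂ A, ℝ)) : Integrable (fun z => φ z) μ :=
  φ.continuous.integrable_of_hasCompactSupport φ.hasCompactSupport

theorem spectralMeasure_smul (A : H →L[ℂ] H) [IsStarNormal A] (c : ℂ) (x : H) :
    spectralMeasure A (c • x) = (‖c‖₊ ^ 2) • spectralMeasure A x := by
  refine Measure.ext_of_integral_eq_on_compactlySupported fun φ => ?_
  rw [integral_smul_nnreal_measure, integral_spectralMeasure, integral_spectralMeasure, map_smul,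
    inner_smul_left, inner_smul_right, ← mul_assoc, ← Complex.normSq_eq_conj_mul_self,
    Complex.re_ofReal_mul, Complex.normSq_eq_norm_sq, NNReal.smul_def]
  simp

theorem spectralMeasure_add (A : H →L[ℂ] H) [IsStarNormal A] (x y y' : H) :
    spectralMeasure A (x + (y + y')) + (spectralMeasure A (x - y) + spectralMeasure A (x - y')) =
    spectralMeasure A (x - (y + y')) + (spectralMeasure A (x + y) + spectralMeasure A (x + y')) := by
  refine Measure.ext_of_integral_eq_on_compactlySupported fun φ => ?_
  have hi := fun v => integrable_compactlySupported A (spectralMeasure A v) φ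
  simp only [integral_add_measure (hi _) ((hi _).add_measure (hi _)),
    integral_add_measure (hi _) (hi _), integral_spectralMeasure]
  simp only [map_add, map_sub, inner_add_left, inner_add_right, inner_sub_left, inner_sub_right,
    Complex.add_re, Complex.sub_re]
  ring

theorem spectralMeasure_real (A : H →L[ℂ] H) [IsStarNormal A] (x y : H) (t : NNReal) :
    spectralMeasure A (x + (t : ℂ) • y) + t • spectralMeasure A (x - y) =
    spectralMeasure A (x - (t : ℂ) • y) + t • spectralMeasure A (x + y) := by
  refine Measure.ext_of_integral_eq_on_compactlySupported fun φ => ?_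
  have hi := fun v => integrable_compactlySupported A (spectralMeasure A v) φ
  have hi' := fun v => integrable_compactlySupported A (t • spectralMeasure A v) φ
  simp only [integral_add_measure (hi _) (hi' _), integral_smul_nnreal_measure,
    integral_spectralMeasure]
  simp only [map_add, map_sub, map_smul, inner_add_left, inner_add_right, inner_sub_left,
    inner_sub_right, inner_smul_left, inner_smul_right, Complex.add_re, Complex.sub_re,
    NNReal.smul_def, smul_eq_mul, Complex.conj_ofReal, Complex.re_ofReal_mul]
  ring

theorem spectralMeasure_univ (A : H →L[ℂ] H) [IsStarNormal A] (x : H) :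
    (spectralMeasure A x).real Set.univ = ‖x‖ ^ 2 := by
  have h := integral_spectralMeasure A x
    ⟨⟨fun _ => 1, continuous_const⟩, HasCompactSupport.of_compactSpace _⟩
  have h1 : complexify A ⟨⟨fun _ => 1, continuous_const⟩, HasCompactSupport.of_compactSpace _⟩
      = 1 := by
    ext z; simp [complexify]
  rw [h1, map_one] at h
  have h2 : (⟪x, x⟫_ℂ).re = ‖x‖ ^ 2 := by
    rw [inner_self_eq_norm_sq_to_K]; norm_cast
  rw [one_apply_eq_self, h2] at h
  simpa using h

/-- Every bounded Borel function on the spectrum of a normal operator defines an operator. -/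
theorem exists_borelCalculus (A : H →L[ℂ] H) [IsStarNormal A] (χ : spectrum ℂ A → ℂ)
    (hχ : Measurable χ) (hb : ∃ C : ℝ, ∀ z, ‖χ z‖ ≤ C) :
    ∃ T : H →L[ℂ] H, ∀ x : H, ⟪x, T x⟫_ℂ = ∫ z, χ z ∂(spectralMeasure A x) := by
  obtain ⟨C, hC⟩ := hb
  have hint : ∀ (μ : Measure (spectrum ℂ A)) [IsFiniteMeasure μ], Integrable χ μ := fun μ _ =>
    Integrable.of_bound hχ.aestronglyMeasurable C (Eventually.of_forall hC)
  set q : H → ℂ := fun x => ∫ z, χ z ∂(spectralMeasure A x) with hq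
  have hqC : ∀ x, ‖q x‖ ≤ C * ‖x‖ ^ 2 := fun x => by
    rw [← spectralMeasure_univ A x]
    exact norm_integral_le_of_norm_le_const (Eventually.of_forall hC)
  have hqs : ∀ (c : ℂ) x, q (c • x) = (‖c‖ ^ 2 : ℝ) * q x := fun c x => by
    simp only [hq, spectralMeasure_smul, integral_smul_nnreal_measure, NNReal.smul_def]
    simp
  have hqI : ∀ x, q (Complex.I • x) = q x := fun x => by simp [hqs]
  have hqn : ∀ x, q (-x) = q x := fun x => by
    have := hqs (-1) x
    simpa using this
  set D : H → H → ℂ := fun x y => q (x + y) - q (x - y) with hD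
  have Dadd : ∀ x y y', D x (y + y') = D x y + D x y' := fun x y y' => by
    have h := congrArg (fun μ => ∫ z, χ z ∂μ) (spectralMeasure_add A x y y')
    simp only [integral_add_measure (hint _) (hint _)] at h
    simp only [hD, hq]
    linear_combination h
  have Dcomm : ∀ x y, D x y = D y x := fun x y => by
    simp only [hD]
    rw [add_comm, ← neg_sub y x, hqn]
  have Dneg : ∀ x y, D x (-y) = - D x y := fun x y => by
    simp only [hD, sub_neg_eq_add, ← sub_eq_add_neg, neg_sub]
  have Dreal0 : ∀ x y (t : NNReal), D x ((t : ℂ) • y) = t * D x y := fun x y t => by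
    have h := congrArg (fun μ => ∫ z, χ z ∂μ) (spectralMeasure_real A x y t)
    simp only [integral_add_measure (hint _) (hint _), integral_smul_nnreal_measure,
      NNReal.smul_def, Complex.real_smul] at h
    simp only [hD, hq]
    linear_combination h
  have Dreal : ∀ x y (t : ℝ), D x ((t : ℂ) • y) = t * D x y := fun x y t => by
    rcases le_total 0 t with ht | ht
    · exact Dreal0 x y ⟨t, ht⟩
    · have h : D x (((-t : ℝ) : ℂ) • y) = ((-t : ℝ) : ℂ) * D x y :=
        Dreal0 x y ⟨-t, neg_nonneg.2 ht⟩
      rw [Complex.ofReal_neg, neg_smul, Dneg] at h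
      linear_combination -h
  have DI : ∀ x y, D (Complex.I • x) (Complex.I • y) = D x y := fun x y => by
    simp only [hD]
    rw [← smul_add, ← smul_sub, hqI, hqI]
  have DI1 : ∀ x y, D (Complex.I • x) y = - D x (Complex.I • y) := fun x y => by
    rw [← DI, ← Dneg, smul_smul, Complex.I_mul_I, neg_one_smul, Dcomm, Dneg, Dcomm, Dneg]
  have Dbd : ∀ x y, ‖D x y‖ ≤ 4 * C * ‖x‖ * ‖y‖ := fun x y => by
    have h0 : ∀ x y, ‖D x y‖ ≤ 2 * C * (‖x‖ ^ 2 + ‖y‖ ^ 2) := fun x y => by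
      have h1 := norm_sub_le (q (x + y)) (q (x - y))
      have h2 := parallelogram_law_with_norm ℂ x y
      have h3 := hqC (x + y)
      have h4 := hqC (x - y)
      calc ‖D x y‖ ≤ C * ‖x + y‖ ^ 2 + C * ‖x - y‖ ^ 2 := by simp only [hD]; linarith
        _ = _ := by linear_combination C * h2
    rcases eq_or_ne x 0 with rfl | hx
    · have : D 0 y = 0 := by simp [hD, hqn]
      simp [this]
    rcases eq_or_ne y 0 with rfl | hy
    · have : D x 0 = 0 := by simp [hD]
      simp [this]
    have hx' : 0 < ‖x‖ := norm_pos_iff.2 hx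
    have hy' : 0 < ‖y‖ := norm_pos_iff.2 hy
    have h := h0 (((‖x‖⁻¹ : ℝ) : ℂ) • x) (((‖y‖⁻¹ : ℝ) : ℂ) • y)
    rw [Dreal, Dcomm, Dreal, Dcomm, norm_mul, norm_mul, norm_smul, norm_smul] at h
    simp only [Complex.norm_real, norm_inv, norm_norm, inv_mul_cancel₀ hx'.ne',
      inv_mul_cancel₀ hy'.ne'] at h
    rw [← mul_assoc, ← mul_inv, inv_mul_le_iff₀ (by positivity)] at h
    linarith
  set B : H → H → ℂ := fun x y => (D x y - Complex.I * D x (Complex.I • y)) / 4 with hB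
  have Badd : ∀ x y y', B x (y + y') = B x y + B x y' := fun x y y' => by
    simp only [hB, smul_add, Dadd]; ring
  have Badd' : ∀ x x' y, B (x + x') y = B x y + B x' y := fun x x' y => by
    simp only [hB, Dcomm _ y, Dcomm _ (Complex.I • y), Dadd]; ring
  have BI : ∀ x y, B x (Complex.I • y) = Complex.I * B x y := fun x y => by
    simp only [hB, smul_smul, Complex.I_mul_I, neg_one_smul, Dneg]
    linear_combination (D x (Complex.I • y) / 4) * Complex.I_mul_I
  have BI' : ∀ x y, B (Complex.I • x) y = -Complex.I * B x y := fun x y => by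
    simp only [hB, DI, DI1]
    linear_combination (-D x (Complex.I • y) / 4) * Complex.I_mul_I
  have Breal : ∀ x y (t : ℝ), B x ((t : ℂ) • y) = t * B x y := fun x y t => by
    simp only [hB, smul_comm Complex.I (t : ℂ), Dreal]; ring
  have Breal' : ∀ x y (t : ℝ), B ((t : ℂ) • x) y = t * B x y := fun x y t => by
    simp only [hB, Dcomm _ y, Dcomm _ (Complex.I • y), Dreal]; ring
  have Bsmul : ∀ (c : ℂ) x y, B x (c • y) = c • B x y := fun c x y => by
    conv_lhs => rw [← Complex.re_add_im c, add_smul, mul_smul, Badd, Breal, Breal, BI]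
    conv_rhs => rw [← Complex.re_add_im c]
    simp only [smul_eq_mul]; ring
  have Bsmul' : ∀ (c : ℂ) x y, B (c • x) y = (starRingEnd ℂ) c • B x y := fun c x y => by
    conv_lhs => rw [← Complex.re_add_im c, add_smul, mul_smul, Badd', Breal', Breal', BI']
    conv_rhs => rw [← Complex.re_add_im c]
    simp only [smul_eq_mul, map_add, map_mul, Complex.conj_ofReal, Complex.conj_I]; ring
  have Bbd : ∀ x y, ‖B x y‖ ≤ (2 * C) * ‖x‖ * ‖y‖ := fun x y => by
    have h1 := Dbd x y
    have h2 := Dbd x (Complex.I • y)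
    have h3 := norm_sub_le (D x y) (Complex.I * D x (Complex.I • y))
    simp only [norm_smul, norm_mul, Complex.norm_I, one_mul] at h2 h3
    have h4 : ‖B x y‖ = ‖D x y - Complex.I * D x (Complex.I • y)‖ / 4 := by
      simp [hB]
    rw [h4]
    linarith
  have Bdiag : ∀ x, B x x = q x := fun x => by
    have e1 : q (x + x) = 4 * q x := by
      rw [← two_smul ℂ x, hqs]; norm_num
    have e2 : q (x + Complex.I • x) = q (x - Complex.I • x) := by
      rw [← hqI (x - Complex.I • x), smul_sub, smul_smul, Complex.I_mul_I, neg_one_smul,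
        sub_neg_eq_add, add_comm]
    have e3 : q 0 = 0 := by simpa using hqs 0 0
    simp only [hB, hD, e1, e2, sub_self, e3]; ring
  let L : H →ₗ⋆[ℂ] H →ₗ[ℂ] ℂ := LinearMap.mk₂'ₛₗ (starRingEnd ℂ) (RingHom.id ℂ) B
    Badd' Bsmul' Badd Bsmul
  let S : H →L[ℂ] H := InnerProductSpace.continuousLinearMapOfBilin
    (LinearMap.mkContinuous₂ L (2 * C) Bbd)
  refine ⟨ContinuousLinearMap.adjoint S, fun x => ?_⟩
  rw [ContinuousLinearMap.adjoint_inner_right,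
    InnerProductSpace.continuousLinearMapOfBilin_apply]
  exact Bdiag x

open Classical in
/-- The Borel functional calculus `χ(A) = ∫ χ dE_A` of a normal operator `A`: the bounded operator
with `⟪x, χ(A) x⟫ = ∫ χ dμ_x` for every `x`. It exists for all bounded Borel `χ : σ(A) → ℂ`, see
`inner_borelCalculus`. -/
def borelCalculus (A : H →L[ℂ] H) [IsStarNormal A] (χ : spectrum ℂ A → ℂ) : H →L[ℂ] H :=
  if h : ∃ T : H →L[ℂ] H, ∀ x : H, ⟪x, T x⟫_ℂ = ∫ z, χ z ∂(spectralMeasure A x)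
  then h.choose else 0

/-- The defining identity of `χ(A)` for a bounded Borel function `χ`. -/
theorem inner_borelCalculus (A : H →L[ℂ] H) [IsStarNormal A] (χ : spectrum ℂ A → ℂ)
    (hχ : Measurable χ) (hb : ∃ C : ℝ, ∀ z, ‖χ z‖ ≤ C) (x : H) :
    ⟪x, borelCalculus A χ x⟫_ℂ = ∫ z, χ z ∂(spectralMeasure A x) := by
  have h := exists_borelCalculus A χ hχ hb
  rw [borelCalculus, dif_pos h]
  exact h.choose_spec x

/-- On continuous functions the Borel calculus is the continuous functional calculus. -/
theorem borelCalculus_eq_cfc (A : H →L[ℂ] H) [IsStarNormal A] (f : ℂ → ℂ)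
    (hf : ContinuousOn f (spectrum ℂ A)) :
    borelCalculus A (fun z => f z) = cfc f A := by
  have hc : Continuous fun z : spectrum ℂ A => f z := continuousOn_iff_continuous_domRestrict.1 hf
  obtain ⟨C, hC⟩ := (isCompact_range hc).isBounded.exists_norm_le
  have hb : ∃ C : ℝ, ∀ z : spectrum ℂ A, ‖f z‖ ≤ C := ⟨C, fun z => hC _ ⟨z, rfl⟩⟩
  rw [cfc_apply f A]
  refine ContinuousLinearMap.coe_injective ((ext_inner_map _ _).1 fun x => ?_)
  rw [ContinuousLinearMap.coe_coe, ContinuousLinearMap.coe_coe]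
  rw [← inner_conj_symm, inner_borelCalculus A _ hc.measurable hb x, ← inner_conj_symm _ x]
  congr 1
  let φ : C_c(spectrum ℂ A, ℝ) := ⟨⟨fun z => (f z).re, Complex.continuous_re.comp hc⟩,
    HasCompactSupport.of_compactSpace _⟩
  let ψ : C_c(spectrum ℂ A, ℝ) := ⟨⟨fun z => (f z).im, Complex.continuous_im.comp hc⟩,
    HasCompactSupport.of_compactSpace _⟩
  have hφ := integral_spectralMeasure A x φ
  have hψ := integral_spectralMeasure A x ψ
  have hreal : ∀ θ : C_c(spectrum ℂ A, ℝ), ((⟪x, cfcHom (R := ℂ) (p := IsStarNormal) (a := A)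
      inferInstance (complexify A θ) x⟫_ℂ).re : ℂ) = ⟪x, cfcHom (R := ℂ) (p := IsStarNormal)
      (a := A) inferInstance (complexify A θ) x⟫_ℂ := fun θ => by
    have h : IsSelfAdjoint (cfcHom (R := ℂ) (p := IsStarNormal) (a := A) inferInstance
        (complexify A θ)) := by
      have : IsSelfAdjoint (complexify A θ) := by
        ext z; simp [complexify]
      exact this.map _
    rw [← Complex.conj_eq_iff_re, inner_conj_symm]
    exact h.isSymmetric x x
  have hsum : (⟨_, hc⟩ : C(spectrum ℂ A, ℂ)) = complexify A φ + Complex.I • complexify A ψ := by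
    ext z
    simp only [ContinuousMap.coe_mk, ContinuousMap.add_apply, ContinuousMap.smul_apply, complexify,
      smul_eq_mul, φ, ψ, CompactlySupportedContinuousMap.coe_mk]
    rw [mul_comm, Complex.re_add_im]
  have hint : Integrable (fun z : spectrum ℂ A => f z) (spectralMeasure A x) := by
    obtain ⟨C, hC⟩ := hb
    exact Integrable.of_bound hc.aestronglyMeasurable C (Eventually.of_forall hC)
  have e := integral_re_add_im hint
  have e1 : ∫ z : spectrum ℂ A, RCLike.re (f z) ∂(spectralMeasure A x) = _ := hφ
  have e2 : ∫ z : spectrum ℂ A, RCLike.im (f z) ∂(spectralMeasure A x) = _ := hψ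
  rw [← e, e1, e2]
  have hs : cfcHom (R := ℂ) (p := IsStarNormal) (a := A) inferInstance
      (⟨_, hc⟩ : C(spectrum ℂ A, ℂ)) = cfcHom (R := ℂ) (p := IsStarNormal) (a := A) inferInstance
      (complexify A φ) + Complex.I • cfcHom (R := ℂ) (p := IsStarNormal) (a := A) inferInstance
      (complexify A ψ) := by
    rw [hsum, map_add, map_smul]
  refine Eq.trans ?_ (congrArg (fun T : H →L[ℂ] H => ⟪x, T x⟫_ℂ) hs).symm
  simp only [_root_.add_apply, _root_.smul_apply, inner_add_right,
    inner_smul_right]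
  rw [← hreal φ, ← hreal ψ, mul_comm Complex.I]
  rfl

end BorelCalculus

/-! ### The multi-layer iteration -/

section Iteration

/-- `partialComposite p j = p_j ∘ ⋯ ∘ p_1`, the composite of the first `j` layers (the layers
`p_1, …, p_K` are indexed from `0` by `Fin K`; for `j ≥ K` it is the composite of all layers). -/
def partialComposite {K : ℕ} (p : Fin K → ℂ → ℂ) : ℕ → ℂ → ℂ
  | 0 => id
  | j + 1 => if h : j < K then p ⟨j, h⟩ ∘ partialComposite p j else partialComposite p j

/-- The composite `f = p_K ∘ ⋯ ∘ p_1` of all layers. -/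
def composite {K : ℕ} (p : Fin K → ℂ → ℂ) : ℂ → ℂ := partialComposite p K

variable {H : Type*} [NormedAddCommGroup H] [InnerProductSpace ℂ H] [CompleteSpace H]

/-- The finite stages of the iteration: `A^(0) = A` and `A^(m+1) = f(A^(m))`, where `f(T)` is the
continuous functional calculus of the normal operator `T`. -/
def stage (f : ℂ → ℂ) (A : H →L[ℂ] H) : ℕ → (H →L[ℂ] H)
  | 0 => A
  | m + 1 => cfc f (stage f A m)

/-- `T` is the limit of the sequence `S` in the strong operator topology. -/
def IsStrongLimit (S : ℕ → (H →L[ℂ] H)) (T : H →L[ℂ] H) : Prop :=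
  ∀ x : H, Tendsto (fun m => S m x) atTop (𝓝 (T x))

end Iteration

end SpectralIteration
end

/-! At finite stages the iteration is the composition rule of the continuous functional calculus:
the layers are continuous on `U`, all intermediate values on `σ(A)` stay in `U`, so `f` is
continuous on each `f^m(σ(A))`, and spectral mapping gives the spectrum.

The limit stage rests on the identity `‖g(A)x‖² = ∫ |g|² dμ_x` (`norm_cfc_apply_sq`). It turns
bounded pointwise convergence into strong convergence: by dominated convergence `f^m(A)x` is Cauchy,
and the quadratic form of the limit is `∫ χ dμ_x`, so the limit is `χ(A)`.

The algebra of `χ(A)` is only needed for bounded pointwise limits of continuous functions. This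
class is closed under products, differences and inverses of functions bounded away from zero, and
strong limits carry products over (`borelCalculus_mul`). Hence `χ(A) - c` has inverse `(χ - c)⁻¹(A)`
when `c` lies off the closure of the range of `χ`, and `χ² = χ` makes `χ(A)` idempotent. -/

namespace SpectralIteration

/-! ### Bounded pointwise limits of continuous functions on the spectrum. -/

section BoundedApproximation

variable {H : Type*} [NormedAddCommGroup H] [InnerProductSpace ℂ H]

/-- The functions `F m` are continuous and uniformly bounded on `σ(A)` and converge to `χ`
pointwise. -/
structure IsBoundedApprox (A : H →L[ℂ] H) (F : ℕ → ℂ → ℂ) (χ : spectrum ℂ A → ℂ) : Prop where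
  continuousOn : ∀ m, ContinuousOn (F m) (spectrum ℂ A)
  bounded : ∃ C : ℝ, ∀ m, ∀ z ∈ spectrum ℂ A, ‖F m z‖ ≤ C
  tendsto : ∀ z : spectrum ℂ A, Tendsto (fun m => F m z) atTop (𝓝 (χ z))

variable {A : H →L[ℂ] H} {F G : ℕ → ℂ → ℂ} {χ ψ : spectrum ℂ A → ℂ}

namespace IsBoundedApprox

theorem measurable (h : IsBoundedApprox A F χ) : Measurable χ :=
  measurable_of_tendsto_metrizable
    (fun m => (continuousOn_iff_continuous_domRestrict.1 (h.continuousOn m)).measurable)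
    (tendsto_pi_nhds.2 h.tendsto)

theorem bounded_limit (h : IsBoundedApprox A F χ) : ∃ C : ℝ, ∀ z, ‖χ z‖ ≤ C := by
  obtain ⟨C, hC⟩ := h.bounded
  exact ⟨C, fun z => le_of_tendsto (h.tendsto z).norm (Eventually.of_forall fun m => hC m z z.2)⟩

theorem const (c : ℂ) : IsBoundedApprox A (fun _ _ => c) (fun _ => c) :=
  ⟨fun _ => continuousOn_const, ⟨‖c‖, fun _ _ _ => le_rfl⟩, fun _ => tendsto_const_nhds⟩

theorem mul (hF : IsBoundedApprox A F χ) (hG : IsBoundedApprox A G ψ) :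
    IsBoundedApprox A (fun m z => F m z * G m z) (fun z => χ z * ψ z) := by
  refine ⟨fun m => (hF.continuousOn m).mul (hG.continuousOn m), ?_,
    fun z => (hF.tendsto z).mul (hG.tendsto z)⟩
  obtain ⟨C, hC⟩ := hF.bounded
  obtain ⟨D, hD⟩ := hG.bounded
  refine ⟨C * D, fun m z hz => ?_⟩
  rw [norm_mul]
  exact mul_le_mul (hC m z hz) (hD m z hz) (norm_nonneg _) ((norm_nonneg _).trans (hC m z hz))

theorem sub (hF : IsBoundedApprox A F χ) (hG : IsBoundedApprox A G ψ) :
    IsBoundedApprox A (fun m z => F m z - G m z) (fun z => χ z - ψ z) := by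
  refine ⟨fun m => (hF.continuousOn m).sub (hG.continuousOn m), ?_,
    fun z => (hF.tendsto z).sub (hG.tendsto z)⟩
  obtain ⟨C, hC⟩ := hF.bounded
  obtain ⟨D, hD⟩ := hG.bounded
  exact ⟨C + D, fun m z hz =>
    (norm_sub_le _ _).trans (add_le_add (hC m z hz) (hD m z hz))⟩

/-- If `χ` is bounded away from zero, then `1 / χ` is a bounded limit of continuous functions. -/
theorem inv (hF : IsBoundedApprox A F χ) {δ : ℝ} (hδ : 0 < δ) (hχ : ∀ z, δ ≤ ‖χ z‖) :
    IsBoundedApprox A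
      (fun m z => (starRingEnd ℂ) (F m z) / ((max (‖F m z‖ ^ 2) (δ ^ 2) : ℝ) : ℂ))
      (fun z => (χ z)⁻¹) := by
  -- `F m` may vanish although `χ` does not. Truncating the denominator of `conj F / |F|²` at `δ²`
  -- keeps the quotient continuous and bounded by `C / δ²`; at the limit the truncation is inactive
  -- because `δ ≤ |χ|`.
  have hpos : ∀ t : ℝ, 0 < max (t ^ 2) (δ ^ 2) := fun t => lt_max_of_lt_right (by positivity)
  refine ⟨fun m => ?_, ?_, fun z => ?_⟩
  · have h := hF.continuousOn m
    refine ContinuousOn.div (Complex.continuous_conj.comp_continuousOn h)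
      (Complex.continuous_ofReal.comp_continuousOn ((h.norm.pow 2).sup continuousOn_const)) ?_
    exact fun z _ => Complex.ofReal_ne_zero.2 (hpos _).ne'
  · obtain ⟨C, hC⟩ := hF.bounded
    refine ⟨C / δ ^ 2, fun m z hz => ?_⟩
    rw [norm_div, RCLike.norm_conj, Complex.norm_real, Real.norm_of_nonneg (hpos _).le]
    exact div_le_div₀ ((norm_nonneg _).trans (hC m z hz)) (hC m z hz) (by positivity)
      (le_max_right _ _)
  · have h := hF.tendsto z
    have hmax : max (‖χ z‖ ^ 2) (δ ^ 2) = ‖χ z‖ ^ 2 :=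
      max_eq_left (pow_le_pow_left₀ hδ.le (hχ z) 2)
    have hlim := ((Complex.continuous_conj.tendsto _).comp h).div
      ((Complex.continuous_ofReal.tendsto _).comp
        ((h.norm.pow 2).max (tendsto_const_nhds (x := δ ^ 2))))
      (Complex.ofReal_ne_zero.2 (hpos _).ne')
    rw [Complex.inv_def, Complex.normSq_eq_norm_sq, ← hmax, Complex.ofReal_inv, ← div_eq_mul_inv]
    exact hlim

end IsBoundedApprox

/-! ### Strong convergence and the resulting calculus for a normal operator. -/

section Normal

variable [CompleteSpace H] [IsStarNormal A]

theorem inner_cfc_eq_integral {f : ℂ → ℂ} (hf : ContinuousOn f (spectrum ℂ A)) (x : H) :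
    ⟪x, cfc f A x⟫_ℂ = ∫ z, f z ∂(spectralMeasure A x) := by
  have h : IsBoundedApprox A (fun _ => f) (fun z => f z) := by
    refine ⟨fun _ => hf, ?_, fun _ => tendsto_const_nhds⟩
    obtain ⟨C, hC⟩ := ((spectrum.isCompact A).image_of_continuousOn hf).isBounded.exists_norm_le
    exact ⟨C, fun _ z hz => hC _ ⟨z, hz, rfl⟩⟩
  rw [← borelCalculus_eq_cfc A f hf, inner_borelCalculus A _ h.measurable h.bounded_limit]

/-- Since `f(A)* f(A) = |f|²(A)`, the map `f ↦ f(A)x` is isometric for the norm of `L²(μ_x)`. -/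
theorem norm_cfc_apply_sq {f : ℂ → ℂ} (hf : ContinuousOn f (spectrum ℂ A)) (x : H) :
    ‖cfc f A x‖ ^ 2 = ∫ z, ‖f z‖ ^ 2 ∂(spectralMeasure A x) := by
  have h1 : ⟪cfc f A x, cfc f A x⟫_ℂ =
      ⟪x, cfc (fun z => star (f z) * f z) A x⟫_ℂ := by
    rw [cfc_mul (fun z => star (f z)) f A, cfc_star f A]
    exact (ContinuousLinearMap.adjoint_inner_right _ _ _).symm
  rw [inner_cfc_eq_integral (f := fun z => star (f z) * f z) (hf.star.mul hf), inner_self_eq_norm_sq_to_K] at h1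
  have h2 : ∀ z : spectrum ℂ A, star (f z) * f z = ((‖f z‖ ^ 2 : ℝ) : ℂ) := fun z => by
    rw [← Complex.normSq_eq_norm_sq, Complex.normSq_eq_conj_mul_self]; rfl
  simp only [h2] at h1
  rw [integral_complex_ofReal] at h1
  exact Complex.ofReal_injective ((Complex.ofReal_pow _ _).trans h1)

namespace IsBoundedApprox

theorem inner_borelCalculus (h : IsBoundedApprox A F χ) (x : H) :
    ⟪x, borelCalculus A χ x⟫_ℂ = ∫ z, χ z ∂(spectralMeasure A x) :=
  SpectralIteration.inner_borelCalculus A χ h.measurable h.bounded_limit x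

/-- The squared distance of two terms is the `L²(μ_x)` distance of `F m` and `F n`, which tends to
zero by dominated convergence over pairs `(m, n)`, with constant bound `(2C)²` on a finite measure.
-/
theorem cauchySeq_cfc_apply (h : IsBoundedApprox A F χ) (x : H) :
    CauchySeq fun m => cfc (F m) A x := by
  obtain ⟨C, hC⟩ := h.bounded
  have hsq : ∀ m n, ‖cfc (F m) A x - cfc (F n) A x‖ ^ 2 =
      ∫ z : spectrum ℂ A, ‖F m z - F n z‖ ^ 2 ∂(spectralMeasure A x) := fun m n => by
    have hm := h.continuousOn m
    have hn := h.continuousOn n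
    rw [← norm_cfc_apply_sq (f := fun z => F m z - F n z) (hm.sub hn), cfc_sub (F m) (F n) A]
    rfl
  have hlim : Tendsto (fun q : ℕ × ℕ =>
      ∫ z : spectrum ℂ A, ‖F q.1 z - F q.2 z‖ ^ 2 ∂(spectralMeasure A x)) atTop (𝓝 0) := by
    rw [← integral_zero (spectrum ℂ A) ℝ (μ := spectralMeasure A x)]
    refine tendsto_integral_filter_of_dominated_convergence (fun _ => (C + C) ^ 2)
      (Eventually.of_forall fun q => ?_)
      (Eventually.of_forall fun q => Eventually.of_forall fun z => ?_)
      (integrable_const _) (Eventually.of_forall fun z => ?_)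
    · have h1 := continuousOn_iff_continuous_domRestrict.1 (h.continuousOn q.1)
      have h2 := continuousOn_iff_continuous_domRestrict.1 (h.continuousOn q.2)
      exact ((h1.sub h2).norm.pow 2).aestronglyMeasurable
    · rw [Real.norm_of_nonneg (by positivity)]
      exact pow_le_pow_left₀ (norm_nonneg _) ((norm_sub_le _ _).trans
        (add_le_add (hC q.1 z z.2) (hC q.2 z z.2))) 2
    · have h1 : Tendsto (fun q : ℕ × ℕ => F q.1 z) atTop (𝓝 (χ z)) := by
        rw [← prod_atTop_atTop_eq]; exact (h.tendsto z).comp tendsto_fst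
      have h2 : Tendsto (fun q : ℕ × ℕ => F q.2 z) atTop (𝓝 (χ z)) := by
        rw [← prod_atTop_atTop_eq]; exact (h.tendsto z).comp tendsto_snd
      simpa using ((h1.sub h2).norm.pow 2)
  rw [cauchySeq_iff_tendsto_dist_atTop_0]
  have hs := hlim.sqrt
  rw [Real.sqrt_zero] at hs
  refine hs.congr fun q => ?_
  rw [← hsq, Real.sqrt_sq (norm_nonneg _), dist_eq_norm]

/-- Bounded pointwise convergence of the functions gives strong convergence of the operators. -/
theorem isStrongLimit (h : IsBoundedApprox A F χ) :
    IsStrongLimit (fun m => cfc (F m) A) (borelCalculus A χ) := by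
  choose L hL using fun x => cauchySeq_tendsto_of_complete (h.cauchySeq_cfc_apply x)
  have hLt : Tendsto (fun m x => cfc (F m) A x) atTop (𝓝 L) := tendsto_pi_nhds.2 hL
  -- The pointwise limit is a bounded operator by Banach–Steinhaus.
  let T : H →L[ℂ] H := continuousLinearMapOfTendsto (fun m => cfc (F m) A) hLt
  suffices hT : T = borelCalculus A χ by
    rw [← hT]; exact hL
  obtain ⟨C, hC⟩ := h.bounded
  -- Over `ℂ` the quadratic form determines the operator; the conjugations only move the operator to
  -- the second slot of the inner product.
  refine ContinuousLinearMap.coe_injective ((ext_inner_map _ _).1 fun x => ?_)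
  rw [ContinuousLinearMap.coe_coe, ContinuousLinearMap.coe_coe, ← inner_conj_symm,
    ← inner_conj_symm _ x]
  congr 1
  have h1 : Tendsto (fun m => ⟪x, cfc (F m) A x⟫_ℂ) atTop (𝓝 ⟪x, T x⟫_ℂ) :=
    tendsto_const_nhds.inner (hL x)
  refine tendsto_nhds_unique h1 ?_
  rw [h.inner_borelCalculus]
  refine Tendsto.congr (fun m => (inner_cfc_eq_integral (h.continuousOn m) x).symm) ?_
  refine tendsto_integral_of_dominated_convergence (fun _ => C) (fun m => ?_)
    (integrable_const _) (fun m => Eventually.of_forall fun z => hC m z z.2)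
    (Eventually.of_forall h.tendsto)
  exact (continuousOn_iff_continuous_domRestrict.1 (h.continuousOn m)).aestronglyMeasurable

/-- Multiplication is jointly strongly continuous on bounded sets: `F_m(A)G_m(A)x = F_m(A)(G_m(A)x -
ψ(A)x) + F_m(A)ψ(A)x`, where the first term vanishes in the limit because `‖F_m(A)‖` is bounded. -/
theorem borelCalculus_mul (hF : IsBoundedApprox A F χ) (hG : IsBoundedApprox A G ψ) :
    borelCalculus A (fun z => χ z * ψ z) = borelCalculus A χ * borelCalculus A ψ := by
  ext x
  refine tendsto_nhds_unique ((hF.mul hG).isStrongLimit x) ?_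
  obtain ⟨C, hC⟩ := hF.bounded
  -- `C` may be negative when the spectrum is empty, hence the maximum with `0`.
  have hb : ∀ m, ‖cfc (F m) A‖ ≤ max C 0 := fun m =>
    norm_cfc_le (le_max_right _ _) fun z hz => (hC m z hz).trans (le_max_left _ _)
  have h0 : Tendsto (fun m => cfc (F m) A (cfc (G m) A x - borelCalculus A ψ x)) atTop (𝓝 0) := by
    have h1 := ((hG.isStrongLimit x).sub_const (borelCalculus A ψ x)).norm.const_mul (max C 0)
    rw [sub_self, norm_zero, mul_zero] at h1
    exact squeeze_zero_norm (fun m => ContinuousLinearMap.le_of_opNorm_le _ (hb m) _) h1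
  have h2 := h0.add (hF.isStrongLimit (borelCalculus A ψ x))
  rw [zero_add] at h2
  refine h2.congr fun m => ?_
  beta_reduce
  rw [cfc_mul (F m) (G m) A (hF.continuousOn m) (hG.continuousOn m), map_sub, sub_add_cancel]
  rfl

theorem borelCalculus_sub (hF : IsBoundedApprox A F χ) (hG : IsBoundedApprox A G ψ) :
    borelCalculus A (fun z => χ z - ψ z) = borelCalculus A χ - borelCalculus A ψ := by
  ext x
  refine tendsto_nhds_unique ((hF.sub hG).isStrongLimit x)
    (((hF.isStrongLimit x).sub (hG.isStrongLimit x)).congr fun m => ?_)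
  beta_reduce
  rw [cfc_sub (F m) (G m) A (hF.continuousOn m) (hG.continuousOn m)]
  rfl

end IsBoundedApprox

theorem borelCalculus_const (c : ℂ) :
    borelCalculus A (fun _ => c) = algebraMap ℂ (H →L[ℂ] H) c := by
  rw [borelCalculus_eq_cfc A (fun _ => c) continuousOn_const, cfc_const c A]

namespace IsBoundedApprox

theorem spectrum_borelCalculus_subset (h : IsBoundedApprox A F χ) :
    spectrum ℂ (borelCalculus A χ) ⊆ closure (Set.range χ) := by
  intro c hc
  by_contra hcl
  obtain ⟨δ, hδ, hd⟩ : ∃ δ > 0, ∀ z, δ ≤ ‖χ z - c‖ := by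
    rw [Metric.mem_closure_iff] at hcl
    push Not at hcl
    obtain ⟨δ, hδ, hd⟩ := hcl
    exact ⟨δ, hδ, fun z => by rw [← dist_eq_norm, dist_comm]; exact hd _ ⟨z, rfl⟩⟩
  have hs := h.sub (const c)
  have hi := hs.inv hδ hd
  have hne : ∀ z, χ z - c ≠ 0 := fun z => norm_pos_iff.1 (hδ.trans_le (hd z))
  -- Both orders of the product are needed for a two-sided inverse.
  have e1 := hs.borelCalculus_mul hi
  have e2 := hi.borelCalculus_mul hs
  simp only [mul_inv_cancel₀ (hne _), inv_mul_cancel₀ (hne _), borelCalculus_const, map_one,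
    h.borelCalculus_sub (const c)] at e1 e2
  have hu : IsUnit (borelCalculus A χ - algebraMap ℂ (H →L[ℂ] H) c) :=
    ⟨⟨_, _, e1.symm, e2.symm⟩, rfl⟩
  rw [spectrum.mem_iff, ← IsUnit.neg_iff, neg_sub] at hc
  exact hc hu

/-- Idempotence comes from `χ² = χ`; self-adjointness holds because the quadratic form `∫ χ dμ_x` is
real. -/
theorem isStarProjection_borelCalculus (h : IsBoundedApprox A F χ) (hχ : ∀ z, χ z = 0 ∨ χ z = 1) :
    IsStarProjection (borelCalculus A χ) := by
  constructor
  · rw [IsIdempotentElem, ← h.borelCalculus_mul h]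
    congr 1
    ext z
    rcases hχ z with hz | hz <;> simp [hz]
  · rw [ContinuousLinearMap.isSelfAdjoint_iff_isSymmetric,
      LinearMap.isSymmetric_iff_inner_map_self_real]
    intro x
    rw [ContinuousLinearMap.coe_coe, inner_conj_symm, ← inner_conj_symm _ x,
      h.inner_borelCalculus, ← integral_conj]
    congr 1
    ext z
    rcases hχ z with hz | hz <;> simp [hz]

end IsBoundedApprox

end Normal

end BoundedApproximation

/-! ### Spectra of nontrivial idempotents. -/

theorem _root_.IsIdempotentElem.zero_mem_spectrum {𝕜 R : Type*} [Field 𝕜] [Ring R] [Algebra 𝕜 R]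
    {e : R} (he : IsIdempotentElem e) (h : e ≠ 1) : (0 : 𝕜) ∈ spectrum 𝕜 e := by
  rw [spectrum.zero_mem_iff]
  intro hu
  exact h (hu.mul_left_cancel (by rw [he.eq, mul_one]))

theorem _root_.IsIdempotentElem.one_mem_spectrum {𝕜 R : Type*} [Field 𝕜] [Ring R] [Algebra 𝕜 R]
    {e : R} (he : IsIdempotentElem e) (h : e ≠ 0) : (1 : 𝕜) ∈ spectrum 𝕜 e := by
  rw [spectrum.mem_iff, map_one]
  intro hu
  exact h (hu.mul_left_cancel (by rw [he.one_sub_mul_self, mul_zero]))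

/-! ### Continuity of the iterates and the finite stages. -/

section Iteration

variable {K : ℕ} {p : Fin K → ℂ → ℂ} {U s : Set ℂ}

theorem continuousOn_partialComposite (hp : ∀ k, ContinuousOn (p k) U)
    (hs : ∀ k : Fin K, Set.MapsTo (partialComposite p k) s U) (j : ℕ) :
    ContinuousOn (partialComposite p j) s := by
  induction j with
  | zero => exact continuousOn_id
  | succ j ih =>
    rw [partialComposite]
    split_ifs with h
    · exact (hp ⟨j, h⟩).comp ih (hs ⟨j, h⟩)
    · exact ih

theorem continuousOn_iterate {f : ℂ → ℂ} (hf : ∀ m : ℕ, ContinuousOn f (f^[m] '' s)) (m : ℕ) :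
    ContinuousOn f^[m] s := by
  induction m with
  | zero => exact continuousOn_id
  | succ m ih =>
    rw [Function.iterate_succ']
    exact (hf m).comp ih (Set.mapsTo_image _ _)

variable {H : Type*} [NormedAddCommGroup H] [InnerProductSpace ℂ H] [CompleteSpace H]

theorem stage_eq_cfc_iterate (A : H →L[ℂ] H) [IsStarNormal A] {f : ℂ → ℂ}
    (hf : ∀ m : ℕ, ContinuousOn f (f^[m] '' spectrum ℂ A)) (m : ℕ) :
    stage f A m = cfc f^[m] A := by
  induction m with
  | zero => exact (cfc_id ℂ A).symm
  | succ m ih =>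
    rw [stage, ih, Function.iterate_succ',
      -- The composition rule asks for continuity of `f` only on the image `f^m(σ(A))`.
      cfc_comp f f^[m] A (hg := hf m) (hf := continuousOn_iterate hf m)]

end Iteration

end SpectralIteration

/-! ### The main theorem. -/

theorem theoremB {H : Type*} [NormedAddCommGroup H] [InnerProductSpace ℂ H] [CompleteSpace H]
    (A : H →L[ℂ] H) [IsStarNormal A]
    (U : Set ℂ) (hU : IsOpen U) (hAU : spectrum ℂ A ⊆ U)
    {K : ℕ} (p : Fin K → ℂ → ℂ)
    (hp : ∀ k, DifferentiableOn ℂ (p k) U)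
    (hp_le : ∀ k, ∀ z ∈ spectrum ℂ A, ‖p k z‖ ≤ 1)
    -- all the compositions that occur in the iterates of `f = p_K ∘ ⋯ ∘ p_1` are defined on `σ(A)`
    (hp_comp : ∀ m : ℕ, ∀ k : Fin K, ∀ z ∈ spectrum ℂ A,
      SpectralIteration.partialComposite p k ((SpectralIteration.composite p)^[m] z) ∈ U) :
    -- (i) finite stages
    (∀ m : ℕ, 1 ≤ m →
      SpectralIteration.stage (SpectralIteration.composite p) A m
          = cfc ((SpectralIteration.composite p)^[m]) A ∧
      spectrum ℂ (SpectralIteration.stage (SpectralIteration.composite p) A m)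
          = spectrum ℂ (cfc ((SpectralIteration.composite p)^[m]) A) ∧
      spectrum ℂ (cfc ((SpectralIteration.composite p)^[m]) A)
          = (SpectralIteration.composite p)^[m] '' spectrum ℂ A) ∧
    -- (ii) limit stage
    (∀ χ : spectrum ℂ A → ℂ,
      (∃ C : ℝ, ∀ m : ℕ, ∀ z ∈ spectrum ℂ A, ‖(SpectralIteration.composite p)^[m] z‖ ≤ C) →
      (∀ z : spectrum ℂ A, Tendsto (fun m : ℕ => (SpectralIteration.composite p)^[m] (z : ℂ))
        atTop (𝓝 (χ z))) →
      ∃ Aω : H →L[ℂ] H,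
        SpectralIteration.IsStrongLimit
          (SpectralIteration.stage (SpectralIteration.composite p) A) Aω ∧
        Aω = SpectralIteration.borelCalculus A χ ∧
        spectrum ℂ Aω ⊆ closure (Set.range χ) ∧
        ((∀ z, χ z = 0 ∨ χ z = 1) →
          IsStarProjection Aω ∧
          spectrum ℂ Aω ⊆ {0, 1} ∧
          (Aω ≠ 0 → Aω ≠ 1 → spectrum ℂ Aω = {0, 1}))) := by
  set f := SpectralIteration.composite p
  have hf : ∀ m : ℕ, ContinuousOn f (f^[m] '' spectrum ℂ A) := fun m =>
    SpectralIteration.continuousOn_partialComposite (fun k => (hp k).continuousOn)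
      (fun k => by rintro _ ⟨z, hz, rfl⟩; exact hp_comp m k z hz) K
  have hc := SpectralIteration.continuousOn_iterate hf
  have hst := SpectralIteration.stage_eq_cfc_iterate A hf
  refine ⟨fun m _ => ⟨hst m, by rw [hst m], cfc_map_spectrum f^[m] A (hf := hc m)⟩, ?_⟩
  intro χ hb hχ
  have h : SpectralIteration.IsBoundedApprox A (fun m => f^[m]) χ := ⟨hc, hb, hχ⟩
  refine ⟨SpectralIteration.borelCalculus A χ, ?_, rfl, h.spectrum_borelCalculus_subset, fun h01 => ?_⟩
  · rw [funext hst]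
    exact h.isStrongLimit
  have hP := h.isStarProjection_borelCalculus h01
  have hsub : spectrum ℂ (SpectralIteration.borelCalculus A χ) ⊆ {0, 1} := by
    -- `{0, 1}` is closed, so taking the closure of the range adds no points outside it.
    refine h.spectrum_borelCalculus_subset.trans
      (closure_minimal ?_ (Set.toFinite {(0 : ℂ), 1}).isClosed)
    rintro _ ⟨z, rfl⟩
    exact h01 z
  refine ⟨hP, hsub, fun h0 h1 => hsub.antisymm ?_⟩
  rintro _ (rfl | rfl)
  · exact hP.isIdempotentElem.zero_mem_spectrum h1
  · exact hP.isIdempotentElem.one_mem_spectrum h0
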